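/- Let $b$ be a prime, $\mathbb{Z}_b$ the field with $b$ elements, and $p\in\mathbb{Z}_b[x]$ irreducible of degree $m\ge 1$. Let $\alpha>0$, let $\gamma=(\gamma_j)_{j\ge1}$ be a sequence of positive reals, and let $s\ge1$. **Definitions.** For $k\in\mathbb{N}_0$ with base-$b$ expansion $k=\sum_{r\ge0}k_r b^r$ put $\mathrm{tr}_m(k)(x)=\sum_{r=0}^{m-1}k_r x^r\in\mathbb{Z}_b[x]$. Put $r_{2\alpha+1,c}(0)=1$, and for $k>0$ with exactly $a$ base-$b$ digits put $r_{2\alpha+1,c}(k)=c\,\frac{b}{(b-1)\,b^{(2\alpha+1)a}}$. For $\boldsymbol q=(q_1,\dots,q_d)\in\mathbb{Z}_b[x]^d$ define $$\mathscr D_p(\boldsymbol q)=\Big\{\boldsymbol k\in\mathbb{N}_0^d:\ \sum_{j=1}^d \mathrm{tr}_m(k_j)\,q_j\equiv 0 \pmod p\Big\},\qquad B(\boldsymbol q,\alpha,\gamma)=\sum_{\boldsymbol k\in\mathscr D_p(\boldsymbol q)\setminus\{\boldsymbol 0\}}\ \prod_{j=1}^d r_{2\alpha+1,\gamma_j}(k_j)\in[0,\infty].$$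 Let $R_{b,m}$ be the set of nonzero polynomials in $\mathbb{Z}_b[x]$ of degree less than $m$. A vector $(q_1,\dots,q_s)\in R_{b,m}^s$ is *constructed by the component-by-component (CBC) algorithm* if $q_1=1$ and, for each $d=2,\dots,s$, the polynomial $q_d$ minimises $g\mapsto B((q_1,\dots,q_{d-1},g),\alpha,\gamma)$ over $g\in R_{b,m}$ (ties broken arbitrarily). **Theorem.** If $(q_1,\dots,q_s)$ is constructed by the CBC algorithm, then for all $d=1,\dots,s$ and all $\lambda$ with $\frac{1}{2\alpha+1}<\lambda\le1$, $$B((q_1,\dots,q_d),\alpha,\gamma)\ \le\ \frac{1}{(b^m-1)^{1/\lambda}}\prod_{j=1}^d\left[1+\gamma_j^{\lambda}\,C_{b,\alpha,\lambda}\right]^{1/\lambda},$$ where $$C_{b,\alpha,\lambda}=\max\left(\frac{1}{(b^{2\alpha}-1)^{\lambda}},\ \frac{(b-1)^{1-\lambda}}{b^{2\alpha\lambda}-b^{1-\lambda}}\right).$$ -/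

import Mathlib

open scoped ENNReal Polynomial

noncomputable section

namespace PolyLattice

/-- The truncated polynomial `tr_m(k)(x) = k_0 + k_1 x + ⋯ + k_{m-1} x^{m-1}` over `ℤ_b`, where
`k = k_0 + k_1 b + ⋯` is the `b`-adic expansion of `k` (the digit `k_r` is `k / b ^ r % b`). -/
def trPoly (b m k : ℕ) : (ZMod b)[X] :=
  ∑ r ∈ Finset.range m, Polynomial.C ((k / b ^ r % b : ℕ) : ZMod b) * Polynomial.X ^ r

/-- The dual polynomial lattice `𝒟_p(q)`: all `k ∈ ℕ₀^d` with
`tr_m(k_1) q_1 + ⋯ + tr_m(k_d) q_d ≡ 0 (mod p)`, where `m = deg p`. -/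
def dualLattice {b d : ℕ} (p : (ZMod b)[X]) (q : Fin d → (ZMod b)[X]) : Set (Fin d → ℕ) :=
  {k | p ∣ ∑ j, trPoly b p.natDegree (k j) * q j}

/-- `r_{β,c}(k)`: it is `1` for `k = 0`, and `c * b / ((b - 1) * b ^ (β * a))` for `k > 0`, where
`a` is the number of base `b` digits of `k`. -/
def r (b : ℕ) (β c : ℝ) (k : ℕ) : ℝ :=
  if k = 0 then 1
  else c * ((b : ℝ) / (((b : ℝ) - 1) * (b : ℝ) ^ (β * ((Nat.digits b k).length : ℝ))))

/-- The product weight `r_{β,γ}(k) = ∏_j r_{β,γ_j}(k_j)`. Weights and coordinates are numbered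
from `0`: the weight of the first coordinate is `γ 0`. -/
def rProd (b : ℕ) (β : ℝ) (γ : ℕ → ℝ) {d : ℕ} (k : Fin d → ℕ) : ℝ :=
  ∏ j : Fin d, r b β (γ j) (k j)

/-- The quality criterion `B(q, α, γ)`, the sum of `r_{2α+1,γ}(k)` over all nonzero `k` in the dual
polynomial lattice. For nonnegative weights the terms are nonnegative; the sum is taken in
`[0, ∞]`, so that it always has its true value. -/
def B {b d : ℕ} (p : (ZMod b)[X]) (q : Fin d → (ZMod b)[X]) (α : ℝ) (γ : ℕ → ℝ) : ℝ≥0∞ :=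
  ∑' k : (dualLattice p q \ {0} : Set (Fin d → ℕ)),
    ENNReal.ofReal (rProd b (2 * α + 1) γ (k : Fin d → ℕ))

/-- `R_{b,m}`: the nonzero polynomials over `ℤ_b` of degree less than `m`. -/
def R (b m : ℕ) : Set (ZMod b)[X] :=
  {g | g.degree < (m : WithBot ℕ) ∧ g ≠ 0}

/-- The first `d` components `(q_1, …, q_d)` of a vector `(q_1, …, q_s)`. -/
def firstComponents {A : Type*} {s : ℕ} (q : Fin s → A) (d : ℕ) (hd : d ≤ s) : Fin d → A :=
  fun j => q (Fin.castLE hd j)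

/-- `q = (q_1, …, q_s)` is a possible output of the component-by-component algorithm with modulus
`p`: all components lie in `R_{b,m}` with `m = deg p`, `q_1 = 1`, and after the choice of
`q_1, …, q_d` (`1 ≤ d < s`) the next component minimizes `g ↦ B((q_1, …, q_d, g), α, γ)` over
`R_{b,m}`; ties may be broken in any way. -/
structure IsCBC {b s : ℕ} (p : (ZMod b)[X]) (α : ℝ) (γ : ℕ → ℝ)
    (q : Fin s → (ZMod b)[X]) : Prop where
  mem : ∀ j, q j ∈ R b p.natDegree
  first : ∀ h : 0 < s, q ⟨0, h⟩ = 1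
  minimal : ∀ (d : ℕ) (hd : d < s), 1 ≤ d → ∀ g ∈ R b p.natDegree,
    B p (Fin.snoc (firstComponents q d hd.le) (q ⟨d, hd⟩) : Fin (d + 1) → (ZMod b)[X]) α γ ≤
      B p (Fin.snoc (firstComponents q d hd.le) g : Fin (d + 1) → (ZMod b)[X]) α γ

/-- The constant `C_{b,α,lam}`. -/
def C (b : ℕ) (α lam : ℝ) : ℝ :=
  max (1 / ((b : ℝ) ^ (2 * α) - 1) ^ lam)
    (((b : ℝ) - 1) ^ (1 - lam) / ((b : ℝ) ^ (2 * α * lam) - (b : ℝ) ^ (1 - lam)))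

end PolyLattice

end

/-!
The proof follows the averaging argument for component-by-component constructions. Write
`β = 2α + 1`, `N = b ^ m`, and let `T_j` be the sum of `r_{β,γ_j}(k) ^ lam` over all `k > 0`. By
induction on `d` one shows
`(N - 1) * B(q_1, …, q_d) ^ lam ≤ ∏_{j ≤ d} (1 + T_j)` (`card_mul_B_rpow_le`).

Appending `g` to `q_1, …, q_d` adds to `B` the sum `θ(g)` over the dual vectors with nonzero last
coordinate (`B_snoc`, where `θ` is `lastPart`). The bound for `B(q_1, …, q_d)` shows that it is
finite, so the algorithm minimizes `θ`, and `(N - 1) * θ(q_{d+1}) ^ lam` is at most the sum of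
`θ(g) ^ lam` over all `N - 1` candidates. By Jensen's inequality (`ENNReal.rpow_tsum_le_tsum_rpow`)
the power may be moved inside, and after interchanging the sums one counts, for fixed
`k_1, …, k_d`, the pairs `(l, g)` with `p ∣ A + tr_m(l) g` where `A = ∑ tr_m(k_j) q_j`
(`tsum_congruence_le`). If `p ∤ A`, every `l` has at most one `g`. If `p ∣ A`, exactly the multiples
of `N` occur, each with all `N - 1` candidates, but `N * r(N l) ^ lam ≤ r(l) ^ lam` because
`β * lam ≥ 1`. In both cases the weighted count is at most `T_{d+1}`, so that
`(N - 1) * θ(q_{d+1}) ^ lam ≤ T_{d+1} * ∏_{j ≤ d} (1 + T_j)`. Adding the two bounds, with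
`(x + y) ^ lam ≤ x ^ lam + y ^ lam`, completes the induction. The step from `0` to `1` is of the
same kind: there `θ(g)` does not depend on `g`.

Grouping the `k > 0` by their number of digits gives a geometric series, whence `T_j` is
`γ_j ^ lam` times the second term of the maximum that defines `C`; only the upper bound
(`tsum_tailWeight_le`) is needed.
-/

/-! ### Generalities on sums in `[0, ∞]` -/

/-- Jensen's inequality for the concave, subadditive power `x ↦ x ^ t` with `0 < t ≤ 1`. -/
theorem ENNReal.rpow_tsum_le_tsum_rpow {ι : Type*} (f : ι → ℝ≥0∞) {t : ℝ} (ht : 0 < t)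
    (ht1 : t ≤ 1) : (∑' i, f i) ^ t ≤ ∑' i, f i ^ t := by
  classical
  have hfin (s : Finset ι) : (∑ i ∈ s, f i) ^ t ≤ ∑ i ∈ s, f i ^ t := by
    induction s using Finset.induction_on with
    | empty => simp [ht]
    | insert a s ha ih =>
      rw [Finset.sum_insert ha, Finset.sum_insert ha]
      exact (ENNReal.rpow_add_le_add_rpow _ _ ht.le ht1).trans (by gcongr)
  rw [← ENNReal.le_rpow_inv_iff ht, ENNReal.tsum_eq_iSup_sum]
  refine iSup_le fun s => (ENNReal.le_rpow_inv_iff ht).2 ?_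
  exact (hfin s).trans (ENNReal.sum_le_tsum s)

/-- A sum over tuples of length `d + 1`, split into the first `d` coordinates and the last. -/
theorem ENNReal.tsum_fin_snoc {d : ℕ} (F : (Fin (d + 1) → ℕ) → ℝ≥0∞) :
    ∑' k, F k = ∑' k : Fin d → ℕ, ∑' l : ℕ, F (Fin.snoc k l) := by
  rw [← (Fin.snocEquiv fun _ : Fin (d + 1) => ℕ).tsum_eq F, ENNReal.tsum_prod', ENNReal.tsum_comm]
  rfl

theorem ENNReal.tsum_prod_eq_prod_tsum (f : ℕ → ℕ → ℝ≥0∞) (d : ℕ) :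
    ∑' k : Fin d → ℕ, ∏ j : Fin d, f j (k j) = ∏ j : Fin d, ∑' l, f j l := by
  induction d with
  | zero => simp
  | succ d ih =>
    rw [ENNReal.tsum_fin_snoc, Fin.prod_univ_castSucc]
    simp only [Fin.prod_univ_castSucc, Fin.snoc_castSucc, Fin.snoc_last, Fin.val_castSucc,
      Fin.val_last, ENNReal.tsum_mul_left]
    rw [ENNReal.tsum_mul_right, ih]

namespace PolyLattice

/-! ### The weights -/

section Weights

variable {b : ℕ} {β c lam : ℝ}

theorem r_nonneg (hb : 1 < b) (hc : 0 ≤ c) (k : ℕ) : 0 ≤ r b β c k := by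
  have : (1 : ℝ) < b := by exact_mod_cast hb
  have : 0 ≤ (b : ℝ) - 1 := by linarith
  unfold r
  split_ifs <;> positivity

theorem r_pow_mul (hb : 1 < b) (n : ℕ) {k : ℕ} (hk : k ≠ 0) :
    r b β c (b ^ n * k) = (b : ℝ) ^ (-(β * n)) * r b β c k := by
  have hb0 : (0 : ℝ) < b := by exact_mod_cast hb.pos
  have h0 : b ^ n * k ≠ 0 := mul_ne_zero (pow_ne_zero _ (by omega)) hk
  rw [r, if_neg h0, r, if_neg hk, Nat.digits_base_pow_mul hb (Nat.pos_of_ne_zero hk),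
    List.length_append, List.length_replicate, Nat.cast_add, mul_add, Real.rpow_add hb0,
    Real.rpow_neg hb0.le]
  field_simp

/-- The summand `r_{β,c}(k) ^ lam`, restricted to `k > 0`. -/
noncomputable def tailWeight (b : ℕ) (β c lam : ℝ) (k : ℕ) : ℝ≥0∞ :=
  if k = 0 then 0 else ENNReal.ofReal (r b β c k) ^ lam

@[simp] theorem tailWeight_zero : tailWeight b β c lam 0 = 0 := if_pos rfl

theorem tailWeight_of_ne_zero {k : ℕ} (hk : k ≠ 0) :
    tailWeight b β c lam k = ENNReal.ofReal (r b β c k) ^ lam := if_neg hk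

theorem tsum_ofReal_r_rpow :
    ∑' k, ENNReal.ofReal (r b β c k) ^ lam = 1 + ∑' k, tailWeight b β c lam k := by
  rw [ENNReal.tsum_eq_add_tsum_ite 0]
  congr 1
  · simp [r]
  · exact tsum_congr fun k => by by_cases hk : k = 0 <;> simp [tailWeight, hk]

/-- Passing from `k` to `b ^ n * k` costs the weight a factor `b ^ (-β * lam * n) ≤ b ^ (-n)`. -/
theorem pow_mul_tailWeight_le (hb : 1 < b) (hlam : 0 < lam) (hβ : 1 ≤ β * lam) (n k : ℕ) :
    (b : ℝ≥0∞) ^ n * tailWeight b β c lam (b ^ n * k) ≤ tailWeight b β c lam k := by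
  rcases eq_or_ne k 0 with rfl | hk
  · simp
  have hb1 : (1 : ℝ) < b := by exact_mod_cast hb
  have hb0 : (0 : ℝ) < b := by linarith
  have h0 : b ^ n * k ≠ 0 := mul_ne_zero (pow_ne_zero _ (by omega)) hk
  rw [tailWeight_of_ne_zero hk, tailWeight_of_ne_zero h0, r_pow_mul hb n hk,
    ENNReal.ofReal_mul (by positivity), ENNReal.mul_rpow_of_nonneg _ _ hlam.le, ← mul_assoc,
    ENNReal.ofReal_rpow_of_nonneg (by positivity) hlam.le, ← Real.rpow_mul hb0.le]
  refine mul_le_of_le_one_left' ?_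
  have : (b : ℝ≥0∞) ^ n = ENNReal.ofReal ((b : ℝ) ^ (n : ℝ)) := by
    rw [Real.rpow_natCast, ENNReal.ofReal_pow hb0.le, ENNReal.ofReal_natCast]
  rw [this, ← ENNReal.ofReal_mul (by positivity), ← Real.rpow_add hb0]
  refine ENNReal.ofReal_le_one.2 (Real.rpow_le_one_of_one_le_of_nonpos hb1.le ?_)
  nlinarith [Nat.cast_nonneg (α := ℝ) n]

theorem length_digits_of_mem_Ico (hb : 1 < b) {n k : ℕ}
    (hk : k ∈ Finset.Ico (b ^ n) (b ^ (n + 1))) :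
    (Nat.digits b k).length = n + 1 := by
  obtain ⟨h1, h2⟩ := Finset.mem_Ico.1 hk
  exact le_antisymm ((Nat.digits_length_le_iff hb k).2 h2) ((Nat.lt_digits_length_iff hb k).2 h1)

/-- `c ^ lam` times this number is the sum of `r_{2α+1,c}(k) ^ lam` over all `k > 0`. -/
noncomputable def tailConst (b : ℕ) (α lam : ℝ) : ℝ :=
  ((b : ℝ) - 1) ^ (1 - lam) / ((b : ℝ) ^ (2 * α * lam) - (b : ℝ) ^ (1 - lam))

theorem tailConst_den_pos {α : ℝ} (hb : 1 < b) (hβ : 1 < (2 * α + 1) * lam) :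
    0 < (b : ℝ) ^ (2 * α * lam) - (b : ℝ) ^ (1 - lam) := by
  have hb1 : (1 : ℝ) < b := by exact_mod_cast hb
  exact sub_pos.2 (Real.rpow_lt_rpow_of_exponent_lt hb1 (by linarith))

theorem tailConst_nonneg {α : ℝ} (hb : 1 < b) (hβ : 1 < (2 * α + 1) * lam) :
    0 ≤ tailConst b α lam := by
  have hb1 : (1 : ℝ) < b := by exact_mod_cast hb
  exact div_nonneg (Real.rpow_nonneg (by linarith) _) (tailConst_den_pos hb hβ).le

/-- The numbers with `n + 1` digits contribute to the tail sum the difference of two consecutive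
terms of a geometric sequence with ratio `b ^ (1 - (2α + 1) lam)`. -/
theorem digit_block_eq {α : ℝ} (hb : 1 < b) (hc : 0 ≤ c) (hβ : 1 < (2 * α + 1) * lam) (n : ℕ) :
    ((b : ℝ) ^ n * (b - 1)) *
        (c * ((b : ℝ) / (((b : ℝ) - 1) * (b : ℝ) ^ ((2 * α + 1) * ((n + 1 : ℕ) : ℝ))))) ^ lam =
      c ^ lam * tailConst b α lam * ((b : ℝ) ^ (1 - (2 * α + 1) * lam)) ^ n -
        c ^ lam * tailConst b α lam * ((b : ℝ) ^ (1 - (2 * α + 1) * lam)) ^ (n + 1) := by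
  have hb1 : (1 : ℝ) < b := by exact_mod_cast hb
  have hb0 : (0 : ℝ) < b := by linarith
  have hb2 : (0 : ℝ) < b - 1 := by linarith
  have hden := tailConst_den_pos hb hβ
  set D := (b : ℝ) ^ (2 * α * lam) - (b : ℝ) ^ (1 - lam) with hD
  set x := (b : ℝ) ^ (1 - (2 * α + 1) * lam) with hx
  have hDx : 1 - x = (b : ℝ) ^ (-(2 * α * lam)) * D := by
    rw [hD, hx, mul_sub, ← Real.rpow_add hb0, ← Real.rpow_add hb0]
    simp only [neg_add_cancel, Real.rpow_zero]
    ring_nf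
  have hbase : (c * ((b : ℝ) / (((b : ℝ) - 1) * (b : ℝ) ^ ((2 * α + 1) * ((n + 1 : ℕ) : ℝ))))) ^ lam
      = c ^ lam * ((b : ℝ) ^ lam / ((b - 1 : ℝ) ^ lam *
          (b : ℝ) ^ ((2 * α + 1) * ((n + 1 : ℕ) : ℝ) * lam))) := by
    rw [Real.mul_rpow hc (by positivity), Real.div_rpow hb0.le (by positivity),
      Real.mul_rpow hb2.le (by positivity), ← Real.rpow_mul hb0.le]
  have hsub : (b - 1 : ℝ) ^ (1 - lam) = (b - 1 : ℝ) / (b - 1 : ℝ) ^ lam := by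
    rw [Real.rpow_sub hb2, Real.rpow_one]
  have hxn : x ^ n * (b : ℝ) ^ (-(2 * α * lam)) = (b : ℝ) ^ n *
      ((b : ℝ) ^ lam / (b : ℝ) ^ ((2 * α + 1) * ((n + 1 : ℕ) : ℝ) * lam)) := by
    rw [hx, ← Real.rpow_natCast, ← Real.rpow_natCast, ← Real.rpow_mul hb0.le, ← Real.rpow_add hb0,
      ← Real.rpow_sub hb0, ← Real.rpow_add hb0]
    congr 1
    push_cast
    ring
  have hR : c ^ lam * tailConst b α lam * x ^ n - c ^ lam * tailConst b α lam * x ^ (n + 1) =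
      c ^ lam * (b - 1 : ℝ) ^ (1 - lam) * (x ^ n * (b : ℝ) ^ (-(2 * α * lam))) := by
    have : c ^ lam * tailConst b α lam * x ^ n - c ^ lam * tailConst b α lam * x ^ (n + 1) =
      c ^ lam * tailConst b α lam * x ^ n * (1 - x) := by ring
    rw [this, hDx, tailConst, ← hD]
    field_simp
  rw [hR, hxn, hbase, hsub]
  have : 0 < (b - 1 : ℝ) ^ lam := Real.rpow_pos_of_pos hb2 _
  field_simp

theorem sum_tailWeight_range_pow {α : ℝ} (hb : 1 < b) (hc : 0 ≤ c) (hlam : 0 < lam)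
    (hβ : 1 < (2 * α + 1) * lam) (n : ℕ) :
    ∑ k ∈ Finset.range (b ^ n), tailWeight b (2 * α + 1) c lam k +
        ENNReal.ofReal (c ^ lam * tailConst b α lam * ((b : ℝ) ^ (1 - (2 * α + 1) * lam)) ^ n) =
      ENNReal.ofReal (c ^ lam * tailConst b α lam) := by
  have hb1 : (1 : ℝ) < b := by exact_mod_cast hb
  have hb2 : (0 : ℝ) < b - 1 := by linarith
  have hA : 0 ≤ c ^ lam * tailConst b α lam :=
    mul_nonneg (Real.rpow_nonneg hc _) (tailConst_nonneg hb hβ)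
  induction n with
  | zero => simp
  | succ n ih =>
    have hle : b ^ n ≤ b ^ (n + 1) := Nat.pow_le_pow_right hb.pos n.le_succ
    have hblock : ∑ k ∈ Finset.Ico (b ^ n) (b ^ (n + 1)), tailWeight b (2 * α + 1) c lam k =
        ENNReal.ofReal (((b : ℝ) ^ n * (b - 1)) *
          (c * ((b : ℝ) / (((b : ℝ) - 1) * (b : ℝ) ^ ((2 * α + 1) * ((n + 1 : ℕ) : ℝ))))) ^ lam) := by
      have hterm : ∀ k ∈ Finset.Ico (b ^ n) (b ^ (n + 1)), tailWeight b (2 * α + 1) c lam k =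
          ENNReal.ofReal ((c * ((b : ℝ) / (((b : ℝ) - 1) *
            (b : ℝ) ^ ((2 * α + 1) * ((n + 1 : ℕ) : ℝ))))) ^ lam) := by
        intro k hk
        have hk0 : k ≠ 0 :=
          ((Nat.pow_pos hb.pos).trans_le (Finset.mem_Ico.1 hk).1).ne'
        rw [tailWeight_of_ne_zero hk0, r, if_neg hk0, length_digits_of_mem_Ico hb hk,
          ENNReal.ofReal_rpow_of_nonneg (by positivity) hlam.le]
      have hcard : ((b ^ (n + 1) - b ^ n : ℕ) : ℝ) = (b : ℝ) ^ n * (b - 1) := by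
        rw [Nat.cast_sub hle]; push_cast; ring
      rw [Finset.sum_congr rfl hterm, Finset.sum_const, Nat.card_Ico, nsmul_eq_mul,
        ← ENNReal.ofReal_natCast, hcard, ← ENNReal.ofReal_mul (by positivity)]
    rw [← Finset.sum_range_add_sum_Ico _ hle, hblock, add_assoc,
      ← ENNReal.ofReal_add (by positivity) (by positivity), digit_block_eq hb hc hβ, sub_add_cancel,
      ih]

theorem tsum_tailWeight_le {α : ℝ} (hb : 1 < b) (hc : 0 ≤ c) (hlam : 0 < lam)
    (hβ : 1 < (2 * α + 1) * lam) :
    ∑' k, tailWeight b (2 * α + 1) c lam k ≤ ENNReal.ofReal (c ^ lam * tailConst b α lam) := by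
  refine ENNReal.tsum_le_of_sum_range_le fun n => ?_
  rw [← sum_tailWeight_range_pow hb hc hlam hβ n]
  refine le_add_right (Finset.sum_le_sum_of_subset ?_)
  exact Finset.range_subset_range.2 (Nat.lt_pow_self hb).le

end Weights

/-! ### Truncated polynomials and the residues in `R_{b,m}` -/

section Residues

variable {b m : ℕ} [Fact b.Prime] {p : (ZMod b)[X]}

theorem degree_trPoly_lt (b m k : ℕ) : (trPoly b m k).degree < (m : WithBot ℕ) := by
  refine (Polynomial.degree_sum_le _ _).trans_lt ((Finset.sup_lt_iff (WithBot.bot_lt_coe m)).2 ?_)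
  intro i hi
  exact (Polynomial.degree_C_mul_X_pow_le _ _).trans_lt
    (WithBot.coe_lt_coe.2 (Finset.mem_range.1 hi))

theorem trPoly_zero_right (b m : ℕ) : trPoly b m 0 = 0 := by simp [trPoly]

theorem trPoly_eq_zero_iff {k : ℕ} : trPoly b m k = 0 ↔ b ^ m ∣ k := by
  have hb : 0 < b := (Fact.out : b.Prime).pos
  constructor
  · intro h
    have hcoeff : ∀ i < m, b ∣ k / b ^ i := by
      intro i hi
      have h' := congrArg (fun f => Polynomial.coeff f i) h
      simp only [trPoly, Polynomial.finsetSum_coeff, Polynomial.coeff_C_mul_X_pow,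
        Polynomial.coeff_zero, Finset.sum_ite_eq, Finset.mem_range, hi, if_true] at h'
      rw [ZMod.natCast_eq_zero_iff] at h'
      exact (Nat.dvd_mod_iff dvd_rfl).1 h'
    have : ∀ n ≤ m, b ^ n ∣ k := by
      intro n
      induction n with
      | zero => simp
      | succ n ih =>
        intro hn
        obtain ⟨l, rfl⟩ := ih (by omega)
        have := hcoeff n (by omega)
        rw [Nat.mul_div_cancel_left _ (Nat.pow_pos hb)] at this
        rw [pow_succ]
        exact mul_dvd_mul_left _ this
    exact this m le_rfl
  · rintro ⟨l, rfl⟩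
    refine Finset.sum_eq_zero fun i hi => ?_
    have hi := Finset.mem_range.1 hi
    have : b ∣ b ^ m * l / b ^ i := by
      obtain ⟨t, rfl⟩ := Nat.exists_eq_add_of_lt hi
      refine ⟨b ^ t * l, ?_⟩
      rw [show b ^ (i + t + 1) * l = b ^ i * (b * (b ^ t * l)) by ring,
        Nat.mul_div_cancel_left _ (Nat.pow_pos hb)]
    rw [Nat.mod_eq_zero_of_dvd this]
    simp

theorem eq_zero_of_dvd_of_degree_lt {f : (ZMod b)[X]} (hp : p ≠ 0)
    (hf : f.degree < (p.natDegree : WithBot ℕ)) (h : p ∣ f) : f = 0 := by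
  rw [← Polynomial.degree_eq_natDegree hp] at hf
  exact Polynomial.eq_zero_of_dvd_of_degree_lt h hf

theorem not_dvd_of_mem_R (hp : p ≠ 0) {g : (ZMod b)[X]} (hg : g ∈ R b p.natDegree) : ¬ p ∣ g :=
  fun h => hg.2 (eq_zero_of_dvd_of_degree_lt hp hg.1 h)

theorem dvd_trPoly_iff (hp : p ≠ 0) {k : ℕ} :
    p ∣ trPoly b p.natDegree k ↔ b ^ p.natDegree ∣ k := by
  rw [← trPoly_eq_zero_iff]
  exact ⟨eq_zero_of_dvd_of_degree_lt hp (degree_trPoly_lt _ _ _), fun h => h ▸ dvd_zero p⟩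

theorem enatCard_R (b m : ℕ) [Fact b.Prime] : ENat.card (R b m) = ((b ^ m - 1 : ℕ) : ℕ∞) := by
  have e := (Polynomial.degreeLTEquiv (ZMod b) m).toEquiv
  have hR : R b m = (Polynomial.degreeLT (ZMod b) m : Set (ZMod b)[X]) \ {0} := by
    ext g
    simp [R, Polynomial.mem_degreeLT]
  have : Finite (Polynomial.degreeLT (ZMod b) m) := Finite.of_equiv _ e.symm
  rw [hR, ← Set.encard, Set.encard_sdiff_singleton_of_mem (by simp), Set.encard]
  have h1 : ENat.card (Polynomial.degreeLT (ZMod b) m : Set (ZMod b)[X]) = ((b ^ m : ℕ) : ℕ∞) := by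
    refine (ENat.card_congr e).trans ?_
    rw [ENat.card_eq_coe_natCard, Nat.card_eq_fintype_card]
    simp [ZMod.card]
  rw [h1]
  rfl

end Residues

/-! ### The averaging argument -/

open scoped Classical in
/-- The averaging estimate behind the choice of the next component. Here `A` stands for the
contribution of the earlier coordinates to the dual lattice congruence, and `f` for the weight of
the new coordinate. If `p ∣ A`, only the multiples `l` of `b ^ m` occur, each of them for every `g`,
and the decay of `f` compensates the number of `g`; otherwise each `l` occurs for at most one `g`. -/
theorem tsum_congruence_le {b : ℕ} [Fact b.Prime] {p : (ZMod b)[X]} (hp : Irreducible p)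
    (f : ℕ → ℝ≥0∞) (hf : ∀ l, (b : ℝ≥0∞) ^ p.natDegree * f (b ^ p.natDegree * l) ≤ f l)
    (A : (ZMod b)[X]) :
    ∑' l, ∑' g : R b p.natDegree, (if p ∣ A + trPoly b p.natDegree l * g then f l else 0) ≤
      ∑' l, f l := by
  have hb : 0 < b := (Fact.out : b.Prime).pos
  by_cases hA : p ∣ A
  · have hiff (l : ℕ) (g : R b p.natDegree) :
        p ∣ A + trPoly b p.natDegree l * g ↔ b ^ p.natDegree ∣ l := by
      rw [dvd_add_right hA, hp.prime.dvd_mul, dvd_trPoly_iff hp.ne_zero,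
        or_iff_left (not_dvd_of_mem_R hp.ne_zero g.2)]
    simp only [hiff, ENNReal.tsum_const, enatCard_R]
    have hinj : Function.Injective fun l : ℕ => b ^ p.natDegree * l :=
      mul_right_injective₀ (pow_ne_zero _ hb.ne')
    rw [← hinj.tsum_eq]
    · refine ENNReal.tsum_le_tsum fun l => le_trans ?_ (hf l)
      rw [if_pos (dvd_mul_right _ _)]
      gcongr
      rw [ENat.toENNReal_coe, ← Nat.cast_pow]
      exact_mod_cast Nat.sub_le _ _
    · intro l hl
      by_contra hl'
      refine hl ?_
      have hndvd : ¬ b ^ p.natDegree ∣ l := fun ⟨t, ht⟩ => hl' ⟨t, ht.symm⟩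
      simp [hndvd]
  · refine ENNReal.tsum_le_tsum fun l => ?_
    by_cases hex : ∃ g : R b p.natDegree, p ∣ A + trPoly b p.natDegree l * g
    · obtain ⟨g₀, hg₀⟩ := hex
      have ht : ¬ p ∣ trPoly b p.natDegree l := fun h =>
        hA ((dvd_add_left (h.mul_right _)).1 hg₀)
      rw [tsum_eq_single g₀]
      · rw [if_pos hg₀]
      · intro g hg
        refine if_neg fun h => hg (Subtype.ext ?_)
        have hsub : p ∣ trPoly b p.natDegree l * ((g : (ZMod b)[X]) - g₀) := by
          convert! dvd_sub h hg₀ using 1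
          ring
        refine sub_eq_zero.1 (eq_zero_of_dvd_of_degree_lt hp.ne_zero ?_
          ((hp.prime.dvd_mul.1 hsub).resolve_left ht))
        exact (Polynomial.degree_sub_le _ _).trans_lt (max_lt g.2.1 g₀.2.1)
    · rw [not_exists] at hex
      simp [hex]

section Criterion

variable {b d : ℕ}

theorem rProd_nonneg {β : ℝ} {γ : ℕ → ℝ} (hb : 1 < b) (hγ : ∀ j, 0 < γ j) (k : Fin d → ℕ) :
    0 ≤ rProd b β γ k :=
  Finset.prod_nonneg fun j _ => r_nonneg hb (hγ j).le _

theorem rProd_snoc (β : ℝ) (γ : ℕ → ℝ) (k : Fin d → ℕ) (l : ℕ) :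
    rProd b β γ (Fin.snoc k l : Fin (d + 1) → ℕ) = rProd b β γ k * r b β (γ d) l := by
  simp [rProd, Fin.prod_univ_castSucc]

theorem snoc_mem_dualLattice_iff {p : (ZMod b)[X]} {q : Fin d → (ZMod b)[X]} {g : (ZMod b)[X]}
    {k : Fin d → ℕ} {l : ℕ} :
    (Fin.snoc k l : Fin (d + 1) → ℕ) ∈
        dualLattice p (Fin.snoc q g : Fin (d + 1) → (ZMod b)[X]) ↔
      p ∣ ∑ j, trPoly b p.natDegree (k j) * q j + trPoly b p.natDegree l * g := by
  simp [dualLattice, Fin.sum_univ_castSucc]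

theorem snoc_eq_zero_iff {k : Fin d → ℕ} {l : ℕ} :
    (Fin.snoc k l : Fin (d + 1) → ℕ) = 0 ↔ k = 0 ∧ l = 0 := by
  constructor
  · intro h
    refine ⟨funext fun j => ?_, ?_⟩
    · simpa using congrFun h j.castSucc
    · simpa using congrFun h (Fin.last d)
  · rintro ⟨rfl, rfl⟩
    funext j
    refine Fin.lastCases ?_ (fun i => ?_) j <;> simp

open scoped Classical in
/-- The part of `B (q_1, …, q_d, g)` that depends on `g`: the sum over the elements of the dual
lattice whose last coordinate does not vanish. -/
noncomputable def lastPart (p : (ZMod b)[X]) (q : Fin d → (ZMod b)[X]) (β : ℝ) (γ : ℕ → ℝ)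
    (g : (ZMod b)[X]) : ℝ≥0∞ :=
  ∑' k : Fin d → ℕ, ∑' l : ℕ,
    if p ∣ ∑ j, trPoly b p.natDegree (k j) * q j + trPoly b p.natDegree l * g then
      ENNReal.ofReal (rProd b β γ k) * tailWeight b β (γ d) 1 l else 0

theorem B_snoc (hb : 1 < b) (p : (ZMod b)[X]) (q : Fin d → (ZMod b)[X]) (α : ℝ) {γ : ℕ → ℝ}
    (hγ : ∀ j, 0 < γ j) (g : (ZMod b)[X]) :
    B p (Fin.snoc q g : Fin (d + 1) → (ZMod b)[X]) α γ =
      B p q α γ + lastPart p q (2 * α + 1) γ g := by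
  classical
  have hB (n : ℕ) (u : Fin n → (ZMod b)[X]) : B p u α γ = ∑' k : Fin n → ℕ,
      if k ∈ dualLattice p u ∧ k ≠ 0 then ENNReal.ofReal (rProd b (2 * α + 1) γ k) else 0 := by
    rw [B, tsum_subtype (dualLattice p u \ {0})
      fun k => ENNReal.ofReal (rProd b (2 * α + 1) γ k)]
    refine tsum_congr fun k => ?_
    rw [Set.indicator_apply]
    rfl
  rw [hB, hB, ENNReal.tsum_fin_snoc, lastPart, ← ENNReal.tsum_add]
  refine tsum_congr fun k => ?_
  rw [ENNReal.tsum_eq_add_tsum_ite 0]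
  congr 1
  · have hmem : (Fin.snoc k 0 : Fin (d + 1) → ℕ) ∈
        dualLattice p (Fin.snoc q g : Fin (d + 1) → (ZMod b)[X]) ↔ k ∈ dualLattice p q := by
      rw [snoc_mem_dualLattice_iff, trPoly_zero_right, zero_mul, add_zero]
      rfl
    simp [hmem, snoc_eq_zero_iff, rProd_snoc, r]
  · refine tsum_congr fun l => ?_
    by_cases hl : l = 0
    · simp [hl]
    · simp [snoc_mem_dualLattice_iff, snoc_eq_zero_iff, rProd_snoc, tailWeight_of_ne_zero,
        ENNReal.ofReal_mul (rProd_nonneg hb hγ k), hl]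

variable [Fact b.Prime]

/-- The mean value estimate: summed over all candidates `g`, the `lam`-th powers of the parts that
depend on `g` stay below the product of the full coordinate sums with the tail sum of the new
coordinate. -/
theorem tsum_lastPart_rpow_le {p : (ZMod b)[X]} (hp : Irreducible p) (q : Fin d → (ZMod b)[X])
    {β lam : ℝ} {γ : ℕ → ℝ} (hγ : ∀ j, 0 < γ j) (hlam : 0 < lam) (hlam1 : lam ≤ 1)
    (hβ : 1 ≤ β * lam) :
    ∑' g : R b p.natDegree, lastPart p q β γ g ^ lam ≤
      (∏ j : Fin d, (1 + ∑' k, tailWeight b β (γ j) lam k)) *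
        ∑' l, tailWeight b β (γ d) lam l := by
  classical
  have hb : 1 < b := (Fact.out : b.Prime).one_lt
  have htail (l : ℕ) : tailWeight b β (γ d) 1 l ^ lam = tailWeight b β (γ d) lam l := by
    by_cases hl : l = 0 <;> simp [tailWeight, hl, hlam]
  have hjensen (g : R b p.natDegree) : lastPart p q β γ g ^ lam ≤
      ∑' k : Fin d → ℕ, ENNReal.ofReal (rProd b β γ k) ^ lam * ∑' l : ℕ,
        if p ∣ ∑ j, trPoly b p.natDegree (k j) * q j + trPoly b p.natDegree l * g then
          tailWeight b β (γ d) lam l else 0 := by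
    refine (ENNReal.rpow_tsum_le_tsum_rpow _ hlam hlam1).trans (ENNReal.tsum_le_tsum fun k => ?_)
    refine (ENNReal.rpow_tsum_le_tsum_rpow _ hlam hlam1).trans ?_
    rw [← ENNReal.tsum_mul_left]
    refine ENNReal.tsum_le_tsum fun l => le_of_eq ?_
    split_ifs
    · rw [ENNReal.mul_rpow_of_nonneg _ _ hlam.le, htail]
    · simp [hlam]
  have hprod : ∑' k : Fin d → ℕ, ENNReal.ofReal (rProd b β γ k) ^ lam =
      ∏ j : Fin d, (1 + ∑' k, tailWeight b β (γ j) lam k) := by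
    simp only [← tsum_ofReal_r_rpow]
    rw [← ENNReal.tsum_prod_eq_prod_tsum fun j k => ENNReal.ofReal (r b β (γ j) k) ^ lam]
    refine tsum_congr fun k => ?_
    rw [rProd, ENNReal.ofReal_prod_of_nonneg fun (j : Fin d) _ => r_nonneg hb (hγ j).le (k j),
      ENNReal.prod_rpow_of_nonneg hlam.le]
  calc _ ≤ _ := ENNReal.tsum_le_tsum hjensen
    _ = ∑' k : Fin d → ℕ, ENNReal.ofReal (rProd b β γ k) ^ lam *
        ∑' l : ℕ, ∑' g : R b p.natDegree,
          if p ∣ ∑ j, trPoly b p.natDegree (k j) * q j + trPoly b p.natDegree l * g then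
            tailWeight b β (γ d) lam l else 0 := by
      rw [ENNReal.tsum_comm]
      refine tsum_congr fun k => ?_
      rw [ENNReal.tsum_mul_left, ENNReal.tsum_comm]
    _ ≤ ∑' k : Fin d → ℕ, ENNReal.ofReal (rProd b β γ k) ^ lam *
        ∑' l, tailWeight b β (γ d) lam l := by
      refine ENNReal.tsum_le_tsum fun k => mul_le_mul_right ?_ _
      exact tsum_congruence_le hp _ (pow_mul_tailWeight_le hb hlam hβ _) _
    _ = _ := by rw [ENNReal.tsum_mul_right, hprod]

/-- A candidate that minimizes the part depending on `g` does no worse than the mean. -/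
theorem card_mul_rpow_le_of_minimal {p : (ZMod b)[X]} (F : (ZMod b)[X] → ℝ≥0∞) {lam : ℝ}
    (hlam : 0 < lam) {x : ℝ≥0∞} (hmin : ∀ g ∈ R b p.natDegree, x ≤ F g) :
    ((b ^ p.natDegree - 1 : ℕ) : ℝ≥0∞) * x ^ lam ≤ ∑' g : R b p.natDegree, F g ^ lam := by
  rw [← ENat.toENNReal_coe, ← enatCard_R, ← ENNReal.tsum_const]
  exact ENNReal.tsum_le_tsum fun g => ENNReal.rpow_le_rpow (hmin g g.2) hlam.le

theorem B_fin_zero (p : (ZMod b)[X]) (q : Fin 0 → (ZMod b)[X]) (α : ℝ) (γ : ℕ → ℝ) :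
    B p q α γ = 0 := by
  refine ENNReal.tsum_eq_zero.2 fun k => ?_
  exact absurd (Subsingleton.elim _ _) k.2.2

/-- In dimension one the part depending on `g` is the same for all admissible `g`, since `p` does
not divide `g`. -/
theorem lastPart_fin_zero_eq {p : (ZMod b)[X]} (hp : Irreducible p) (q : Fin 0 → (ZMod b)[X])
    (β : ℝ) (γ : ℕ → ℝ) {g g' : (ZMod b)[X]} (hg : g ∈ R b p.natDegree)
    (hg' : g' ∈ R b p.natDegree) : lastPart p q β γ g = lastPart p q β γ g' := by
  classical
  refine tsum_congr fun k => tsum_congr fun l => if_congr ?_ rfl rfl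
  rw [Fin.sum_univ_zero, zero_add, zero_add, hp.prime.dvd_mul, hp.prime.dvd_mul,
    or_iff_left (not_dvd_of_mem_R hp.ne_zero hg), or_iff_left (not_dvd_of_mem_R hp.ne_zero hg')]

theorem firstComponents_succ {A : Type*} {s : ℕ} (q : Fin s → A) (d : ℕ) (hd : d < s) :
    firstComponents q (d + 1) hd =
      (Fin.snoc (firstComponents q d hd.le) (q ⟨d, hd⟩) : Fin (d + 1) → A) := by
  funext j
  refine Fin.lastCases ?_ (fun i => ?_) j
  · simp only [Fin.snoc_last]; rfl
  · simp only [Fin.snoc_castSucc]; rfl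

/-- The bound of the theorem with the exact tail sums, raised to the power `lam`. -/
theorem card_mul_B_rpow_le {p : (ZMod b)[X]} (hp : Irreducible p) {α lam : ℝ} {γ : ℕ → ℝ}
    (hγ : ∀ j, 0 < γ j) {s : ℕ} {q : Fin s → (ZMod b)[X]} (hq : IsCBC p α γ q) (hlam : 0 < lam)
    (hlam1 : lam ≤ 1) (hβ : 1 < (2 * α + 1) * lam) (d : ℕ) (hd : d ≤ s) :
    ((b ^ p.natDegree - 1 : ℕ) : ℝ≥0∞) * B p (firstComponents q d hd) α γ ^ lam ≤
      ∏ j : Fin d, (1 + ∑' k, tailWeight b (2 * α + 1) (γ j) lam k) := by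
  have hb : 1 < b := (Fact.out : b.Prime).one_lt
  induction d with
  | zero => rw [B_fin_zero]; simp [hlam]
  | succ d ih =>
    set u := firstComponents q d (Nat.le_of_succ_le hd) with hu
    have ih := ih (Nat.le_of_succ_le hd)
    have hN : ((b ^ p.natDegree - 1 : ℕ) : ℝ≥0∞) ≠ 0 := by
      have := Nat.one_lt_pow hp.natDegree_pos.ne' hb
      exact_mod_cast (by omega : b ^ p.natDegree - 1 ≠ 0)
    have hfin : B p u α γ ≠ ∞ := by
      have hprod : ∏ j : Fin d, (1 + ∑' k, tailWeight b (2 * α + 1) (γ j) lam k) ≠ ∞ :=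
        ENNReal.prod_ne_top fun j _ => ENNReal.add_ne_top.2 ⟨ENNReal.one_ne_top,
          ne_top_of_le_ne_top ENNReal.ofReal_ne_top (tsum_tailWeight_le hb (hγ j).le hlam hβ)⟩
      intro h
      rw [← hu, h, ENNReal.top_rpow_of_pos hlam, ENNReal.mul_top hN] at ih
      exact hprod (top_le_iff.1 ih)
    have hmin : ∀ g ∈ R b p.natDegree,
        lastPart p u (2 * α + 1) γ (q ⟨d, hd⟩) ≤ lastPart p u (2 * α + 1) γ g := by
      intro g hg
      rcases Nat.eq_zero_or_pos d with rfl | hd0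
      · exact (lastPart_fin_zero_eq hp u _ γ (hq.mem _) hg).le
      · have h := hq.minimal d hd hd0 g hg
        rw [B_snoc hb p _ α hγ, B_snoc hb p _ α hγ] at h
        -- the finite common part may be cancelled
        exact (ENNReal.add_le_add_iff_left hfin).1 h
    have hlast := (card_mul_rpow_le_of_minimal _ hlam hmin).trans
      (tsum_lastPart_rpow_le hp u hγ hlam hlam1 hβ.le)
    rw [firstComponents_succ q d hd, B_snoc hb p _ α hγ, Fin.prod_univ_castSucc]
    calc _ ≤ ((b ^ p.natDegree - 1 : ℕ) : ℝ≥0∞) *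
          (B p u α γ ^ lam + lastPart p u (2 * α + 1) γ (q ⟨d, hd⟩) ^ lam) := by
          gcongr
          exact ENNReal.rpow_add_le_add_rpow _ _ hlam.le hlam1
      _ ≤ _ := by
          rw [mul_add, mul_add, mul_one]
          exact add_le_add ih hlast

end Criterion

end PolyLattice

theorem theorem4p1 (b : ℕ) [Fact b.Prime] (m : ℕ) (hm : 1 ≤ m)
    (p : Polynomial (ZMod b)) (hp : Irreducible p) (hdeg : p.natDegree = m)
    (α : ℝ) (hα : 0 < α) (γ : ℕ → ℝ) (hγ : ∀ j, 0 < γ j)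
    (s : ℕ) (q : Fin s → Polynomial (ZMod b)) (hq : PolyLattice.IsCBC p α γ q) :
    ∀ (d : ℕ) (_ : 1 ≤ d) (hd : d ≤ s) (lam : ℝ), 1 / (2 * α + 1) < lam → lam ≤ 1 →
      PolyLattice.B p (PolyLattice.firstComponents q d hd) α γ ≤
        ENNReal.ofReal (1 / ((b : ℝ) ^ m - 1) ^ (1 / lam) *
          ∏ j : Fin d, (1 + γ j ^ lam * PolyLattice.C b α lam) ^ (1 / lam)) := by
  intro d _ hd lam hlow hlam1
  subst hdeg
  have hb : 1 < b := (Fact.out : b.Prime).one_lt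
  have hb1 : (1 : ℝ) < b := by exact_mod_cast hb
  have hα1 : 0 < 2 * α + 1 := by linarith
  have hlam : 0 < lam := lt_trans (by positivity) hlow
  have hβ : 1 < (2 * α + 1) * lam := by
    rw [div_lt_iff₀ hα1] at hlow
    linarith
  have hN : 0 < (b : ℝ) ^ p.natDegree - 1 := sub_pos.2 (one_lt_pow₀ hb1 (by omega))
  -- the second term of the maximum is never the smaller one, so the first is not needed
  have hC : PolyLattice.tailConst b α lam ≤ PolyLattice.C b α lam := le_max_right _ _
  have hC0 : 0 ≤ PolyLattice.C b α lam := (PolyLattice.tailConst_nonneg hb hβ).trans hC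
  have hfac (j : Fin d) : 0 ≤ 1 + γ j ^ lam * PolyLattice.C b α lam :=
    add_nonneg zero_le_one (mul_nonneg (Real.rpow_nonneg (hγ j).le _) hC0)
  have hprod : ∏ j : Fin d, (1 + ∑' k, PolyLattice.tailWeight b (2 * α + 1) (γ j) lam k) ≤
      ENNReal.ofReal (∏ j : Fin d, (1 + γ j ^ lam * PolyLattice.C b α lam)) := by
    rw [ENNReal.ofReal_prod_of_nonneg fun j _ => hfac j]
    refine Finset.prod_le_prod' fun j _ => ?_
    rw [ENNReal.ofReal_add zero_le_one (mul_nonneg (Real.rpow_nonneg (hγ j).le _) hC0),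
      ENNReal.ofReal_one]
    gcongr
    refine (PolyLattice.tsum_tailWeight_le hb (hγ j).le hlam hβ).trans
      (ENNReal.ofReal_le_ofReal ?_)
    exact mul_le_mul_of_nonneg_left hC (Real.rpow_nonneg (hγ j).le _)
  have hmain := (PolyLattice.card_mul_B_rpow_le hp hγ hq hlam hlam1 hβ d hd).trans hprod
  have hcast : ((b ^ p.natDegree - 1 : ℕ) : ENNReal) =
      ENNReal.ofReal ((b : ℝ) ^ p.natDegree - 1) := by
    rw [← ENNReal.ofReal_natCast, Nat.cast_sub (Nat.one_le_pow _ _ (by omega))]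
    push_cast
    rfl
  have hrhs : 1 / ((b : ℝ) ^ p.natDegree - 1) ^ (1 / lam) *
      ∏ j : Fin d, (1 + γ j ^ lam * PolyLattice.C b α lam) ^ (1 / lam) =
      ((∏ j : Fin d, (1 + γ j ^ lam * PolyLattice.C b α lam)) /
        ((b : ℝ) ^ p.natDegree - 1)) ^ lam⁻¹ := by
    rw [one_div lam, Real.finsetProd_rpow _ _ fun j _ => hfac j,
      Real.div_rpow (Finset.prod_nonneg fun j _ => hfac j) hN.le]
    ring
  rw [hrhs, ← ENNReal.ofReal_rpow_of_nonneg
      (div_nonneg (Finset.prod_nonneg fun j _ => hfac j) hN.le) (inv_nonneg.2 hlam.le),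
    ENNReal.le_rpow_inv_iff hlam, ENNReal.ofReal_div_of_pos hN, ← hcast,
    ENNReal.le_div_iff_mul_le (Or.inl (by rw [hcast]; simpa using hN))
      (Or.inl (ENNReal.natCast_ne_top _)), mul_comm]
  exact hmain
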